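/- Let $G$ be a semi-simple algebraic group with maximal torus $T$ and Borel subgroup $B\supset T$; let $\Delta$ be its root system (finite, crystallographic, reduced), $S$ the set of simple roots, $W$ the Weyl group with length function $\ell$ (with respect to the simple reflections), and $w_0\in W$ the longest element. Let $i$ be the Weyl involution $i(\gamma)=-w_0(\gamma)$ on $S$. Let $\varpi$ be a minuscule weight, that is, a fundamental weight with $\langle\alpha^\vee,\varpi\rangle\le 1$ for every positive root $\alpha$, and let $W_{P_\varpi}\subset W$ be the subgroup generated by the simple reflections $s_\gamma$ with $\langle\gamma^\vee,\varpi\rangle=0$. Let $\gamma_1,\dots,\gamma_n$ be simple roots, put $\phi=s_{\gamma_1}\cdots s_{\gamma_n}\in W$, and suppose that $\ell(\phi)=n$ and that $\phi$ is the smallest element (the element of minimal length) of its coset $\phi W_{P_\varpi}$. Set $\beta_k=i(\gamma_k)$ and $$\alpha_1=\beta_1,\quad \alpha_2=s_{\beta_1}(\beta_2),\quad\dots,\quad \alpha_n=s_{\beta_1}\cdots s_{\beta_{n-1}}(\beta_n).$$ Then for all $i,j\in\{1,\dots,n\}$, $$\langle\alpha_i^\vee,\alpha_j\rangle\ge 0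 .$$ -/

import Mathlib

noncomputable section

namespace RootPairing

variable {ι k V V' : Type*} [Field k] [AddCommGroup V] [Module k V] [AddCommGroup V'] [Module k V']

/-- The product `s_{γ₁} ⋯ s_{γₙ}` in the Weyl group, for a list `γ₁, …, γₙ` of (indices of)
roots. -/
def reflectionProd (P : RootPairing ι k V V') (l : List ι) : P.weylGroup :=
  (l.map (weylGroup.ofIdx P)).prod

/-- For a sequence of roots `β₁, …, βₙ`, the sequence of roots `α₁ = β₁`, `α₂ = s_{β₁}(β₂)`, …,
`αₙ = s_{β₁} ⋯ s_{βₙ₋₁}(βₙ)` (indices are shifted by one: `j : Fin n` stands for `j + 1`). -/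
def associatedRoots (P : RootPairing ι k V V') {n : ℕ} (β : Fin n → ι) (j : Fin n) : ι :=
  reflectionProd P ((List.ofFn β).take j) • β j

namespace Base

variable {P : RootPairing ι k V V'} (b : P.Base)

/-- The length of an element of the Weyl group: the least `n` such that `w` is a product of `n`
simple reflections. -/
def length (w : P.weylGroup) : ℕ :=
  sInf {n : ℕ | ∃ l : List ι, (∀ i ∈ l, i ∈ b.support) ∧ l.length = n ∧ reflectionProd P l = w}

/-- `ϖ` is a fundamental weight: there is a simple root `β` such that `⟨β^∨, ϖ⟩ = 1` and
`⟨γ^∨, ϖ⟩ = 0` for each simple root `γ ≠ β`. -/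
def IsFundamentalWeight (ϖ : V) : Prop :=
  ∃ i ∈ b.support, P.coroot' i ϖ = 1 ∧ ∀ j ∈ b.support, j ≠ i → P.coroot' j ϖ = 0

/-- A fundamental weight `ϖ` is minuscule if `⟨α^∨, ϖ⟩ ≤ 1` for each positive root `α`. -/
def IsMinuscule [LinearOrder k] [IsStrictOrderedRing k] (ϖ : V) : Prop :=
  b.IsFundamentalWeight ϖ ∧ ∀ i : ι, b.IsPos i → P.coroot' i ϖ ≤ 1

/-- The subgroup `W_{P_ϖ}` of the Weyl group attached to the standard parabolic subgroup `P_ϖ`: it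
is generated by the simple reflections `s_γ` with `⟨γ^∨, ϖ⟩ = 0`. -/
def parabolicWeylSubgroup (ϖ : V) : Subgroup P.weylGroup :=
  Subgroup.closure (weylGroup.ofIdx P '' {i : ι | i ∈ b.support ∧ P.coroot' i ϖ = 0})

/-- `w` is the smallest element of its coset `w W_{P_ϖ}`, i.e. it has minimal length there. -/
def IsMinimalRepresentative (ϖ : V) (w : P.weylGroup) : Prop :=
  ∀ v ∈ b.parabolicWeylSubgroup ϖ, b.length w ≤ b.length (w * v)

lemma weylGroup_ext {g h : P.weylGroup} (hgh : ∀ x : V, g • x = h • x) : g = h := by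
  apply Subtype.ext
  apply Equiv.weightHom_injective P
  ext x
  exact hgh x

lemma finite_weylGroup [Finite ι] [P.IsRootSystem] : Finite P.weylGroup := by
  refine Finite.of_injective (fun w : P.weylGroup ↦ P.weylGroupToPerm w) fun g h hgh ↦ ?_
  refine weylGroup_ext fun x ↦ ?_
  have hx : x ∈ Submodule.span k (Set.range P.root) := by
    rw [IsRootSystem.span_root_eq_top]; trivial
  induction hx using Submodule.span_induction with
  | mem x hx =>
    obtain ⟨i, rfl⟩ := hx
    rw [P.weylGroup_apply_root g i, P.weylGroup_apply_root h i]
    exact congrArg (fun e : Equiv.Perm ι ↦ P.root (e i)) hgh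
  | zero => simp
  | add x y _ _ hx hy => rw [smul_add, smul_add, hx, hy]
  | smul a x _ hx =>
    have hs (w : P.weylGroup) : w • a • x = a • w • x := smul_comm w.1 a x
    rw [hs, hs, hx]

/-- Each element of the Weyl group is a product of simple reflections, so the set in the definition
of the length is never empty. -/
lemma exists_reflectionProd_eq [CharZero k] [Finite ι] [P.IsReduced] [P.IsCrystallographic]
    (w : P.weylGroup) :
    ∃ l : List ι, (∀ i ∈ l, i ∈ b.support) ∧ reflectionProd P l = w := by
  classical
  have hrefl (i : ι) :
      ∃ l : List ι, (∀ j ∈ l, j ∈ b.support) ∧ reflectionProd P l = weylGroup.ofIdx P i := by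
    induction i using b.induction_reflect with
    | h₀ i ih =>
      obtain ⟨l, hl, hl'⟩ := ih
      refine ⟨l, hl, hl'.trans (weylGroup_ext fun x ↦ ?_)⟩
      have hr : P.reflection (P.reflectionPerm i i) = P.reflection i := by
        ext y; simp [reflection_apply, two_smul]
      exact (LinearEquiv.congr_fun hr x).symm
    | h₁ i hi => exact ⟨[i], by simpa using hi, by simp [reflectionProd]⟩
    | h₂ i j ih hj =>
      obtain ⟨l, hl, hl'⟩ := ih
      refine ⟨j :: l ++ [j], ?_, ?_⟩
      · intro x hx
        simp only [List.cons_append, List.mem_cons, List.mem_append, List.not_mem_nil,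
          or_false] at hx
        rcases hx with rfl | hx | rfl
        exacts [hj, hl x hx, hj]
      · have : reflectionProd P (j :: l ++ [j]) =
            weylGroup.ofIdx P j * reflectionProd P l * weylGroup.ofIdx P j := by
          simp [reflectionProd, mul_assoc]
        rw [this, hl']
        refine weylGroup_ext fun x ↦ ?_
        exact (LinearEquiv.congr_fun (P.reflection_reflectionPerm (i := i) (j := j)) x).symm
  obtain ⟨w, hw⟩ := w
  induction hw using weylGroup.induction with
  | mem i => exact hrefl i
  | one => exact ⟨[], by simp, rfl⟩
  | mul x y hx hy ihx ihy =>
    obtain ⟨l, hl, hl'⟩ := ihx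
    obtain ⟨m, hm, hm'⟩ := ihy
    refine ⟨l ++ m, fun i hi ↦ (List.mem_append.mp hi).elim (hl i) (hm i), ?_⟩
    have : reflectionProd P (l ++ m) = reflectionProd P l * reflectionProd P m := by
      simp [reflectionProd]
    rw [this, hl', hm']
    rfl

lemma exists_length_max [Finite ι] [P.IsRootSystem] :
    ∃ w₀ : P.weylGroup, ∀ w : P.weylGroup, b.length w ≤ b.length w₀ := by
  have := finite_weylGroup (P := P)
  exact Finite.exists_max b.length

/-- The longest element `w₀` of the Weyl group. -/
def longestElement [Finite ι] [P.IsRootSystem] : P.weylGroup :=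
  b.exists_length_max.choose

lemma length_le_length_longestElement [Finite ι] [P.IsRootSystem] (w : P.weylGroup) :
    b.length w ≤ b.length b.longestElement :=
  b.exists_length_max.choose_spec w

/-- The Weyl involution `β ↦ -w₀(β)`, on the indices of the roots. -/
def weylInvolution [Finite ι] [P.IsRootSystem] (i : ι) : ι :=
  P.indexNeg.neg (b.longestElement • i)

lemma root_weylInvolution [Finite ι] [P.IsRootSystem] (i : ι) :
    P.root (b.weylInvolution i) = -(b.longestElement • P.root i) := by
  have h := P.weylGroup_apply_root b.longestElement i
  have h' : P.root (b.weylInvolution i) = -P.root (b.longestElement • i) := by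
    simp [weylInvolution]
  exact h'.trans (congrArg Neg.neg h.symm)

end Base

end RootPairing

end

/-! Conjugation by $w_0$ takes $s_{\gamma}$ to $s_{i(\gamma)}$, so the $\beta$-word unwinds to
$\alpha_k = w_0\phi(e_k)$, where $e_k = s_{\gamma_n}\cdots s_{\gamma_{k+1}}(\gamma_k)$ are the
inversions of $\phi$. The pairing is Weyl-invariant, so it is enough to treat the $e_k$. Each $e_k$
is positive because the word is reduced. If $\langle e_k^\vee,\varpi\rangle = 0$, then $s_{e_k}\in
W_{P_\varpi}$, while $\phi s_{e_k}$ is the word with its $k$-th letter deleted, against minimality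
of $\phi$. As $\varpi$ is minuscule, $\langle e_k^\vee,\varpi\rangle = 1$. A negative pairing of
$e_j$ and $e_k$ would give a reflected coroot with value greater than 1 on $\varpi$; see
`IsMinuscule.pairing_nonneg`. -/

noncomputable section

namespace RootPairing

/-! ### Weyl group action on roots and coroots -/

section

variable {ι k V V' : Type*} [Field k] [AddCommGroup V] [Module k V] [AddCommGroup V'] [Module k V']
  (P : RootPairing ι k V V')

lemma root_weylGroup_smul (w : P.weylGroup) (i : ι) : P.root (w • i) = w • P.root i :=
  (P.weylGroup_apply_root w i).symm

lemma reflectionProd_cons (i : ι) (l : List ι) :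
    reflectionProd P (i :: l) = weylGroup.ofIdx P i * reflectionProd P l := by
  simp [reflectionProd]

lemma reflectionProd_append (l m : List ι) :
    reflectionProd P (l ++ m) = reflectionProd P l * reflectionProd P m := by
  simp [reflectionProd]

lemma weylGroup_ofIdx_smul_eq (i j : ι) :
    weylGroup.ofIdx P i • j = P.reflectionPerm i j := rfl

lemma weylGroup_ofIdx_smul_vec (i : ι) (x : V) :
    weylGroup.ofIdx P i • x = P.reflection i x := rfl

lemma weylGroup_ofIdx_mul_self (i : ι) :
    weylGroup.ofIdx P i * weylGroup.ofIdx P i = 1 :=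
  Base.weylGroup_ext fun x ↦ by
    rw [mul_smul, weylGroup_ofIdx_smul_vec, weylGroup_ofIdx_smul_vec, one_smul]
    exact P.reflection_same i x

lemma weylGroup_ofIdx_reflectionPerm (i j : ι) :
    weylGroup.ofIdx P (P.reflectionPerm j i) =
      weylGroup.ofIdx P j * weylGroup.ofIdx P i * weylGroup.ofIdx P j :=
  Base.weylGroup_ext fun x ↦
    LinearEquiv.congr_fun (P.reflection_reflectionPerm (i := i) (j := j)) x

lemma weylGroup_ofIdx_smul_conj (w : P.weylGroup) (i : ι) :
    weylGroup.ofIdx P (w • i) = w * weylGroup.ofIdx P i * w⁻¹ := by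
  obtain ⟨w, hw⟩ := w
  induction hw using weylGroup.induction generalizing i with
  | mem j =>
    change weylGroup.ofIdx P (P.reflectionPerm j i) = weylGroup.ofIdx P j * weylGroup.ofIdx P i *
      (weylGroup.ofIdx P j)⁻¹
    rw [weylGroup_ofIdx_reflectionPerm, inv_eq_of_mul_eq_one_left (P.weylGroup_ofIdx_mul_self j)]
  | one =>
    change weylGroup.ofIdx P ((1 : P.weylGroup) • i) = (1 : P.weylGroup) * _ * (1 : P.weylGroup)⁻¹
    simp
  | mul x y hx hy ihx ihy =>
    change weylGroup.ofIdx P (((⟨x, hx⟩ : P.weylGroup) * ⟨y, hy⟩) • i) =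
      ((⟨x, hx⟩ : P.weylGroup) * ⟨y, hy⟩) * _ * ((⟨x, hx⟩ : P.weylGroup) * ⟨y, hy⟩)⁻¹
    rw [mul_smul, ihx, ihy, mul_inv_rev]
    simp only [mul_assoc]

lemma pairing_weylGroup_smul (w : P.weylGroup) (i j : ι) :
    P.pairing (w • i) (w • j) = P.pairing i j := by
  obtain ⟨w, hw⟩ := w
  induction hw using weylGroup.induction generalizing i j with
  | mem l =>
    change P.pairing (P.reflectionPerm l i) (P.reflectionPerm l j) = P.pairing i j
    rw [← pairing_reflectionPerm, P.reflectionPerm_self]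
  | one => exact congrArg₂ P.pairing (one_smul P.weylGroup i) (one_smul P.weylGroup j)
  | mul x y hx hy ihx ihy => exact (ihx _ _).trans (ihy i j)

lemma coroot'_reflectionPerm_apply (i j : ι) (x : V) :
    P.coroot' (P.reflectionPerm i j) x = P.coroot' j x - P.pairing i j * P.coroot' i x := by
  rw [coroot'_reflectionPerm]
  simp [reflection_apply, mul_comm]

lemma coroot'_reflectionPerm_self_apply (i : ι) (x : V) :
    P.coroot' (P.reflectionPerm i i) x = -P.coroot' i x := by
  rw [coroot'_reflectionPerm_apply, pairing_same]; ring

end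

namespace Base

/-! ### Words and the Weyl involution -/

section

variable {ι k V V' : Type*} [Field k] [AddCommGroup V] [Module k V] [AddCommGroup V'] [Module k V']
  {P : RootPairing ι k V V'} (b : P.Base) {ϖ : V}

lemma pairing_eq_natCast_of_pos [CharZero k] [P.IsCrystallographic] {i j : ι}
    (h : 0 < P.pairingIn ℤ i j) :
    ∃ m : ℕ, 0 < m ∧ P.pairing i j = m := by
  refine ⟨(P.pairingIn ℤ i j).toNat, by lia, ?_⟩
  rw [← P.algebraMap_pairingIn ℤ, ← Int.cast_natCast, Int.toNat_of_nonneg h.le]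
  simp

lemma length_reflectionProd_le {l : List ι} (hl : ∀ i ∈ l, i ∈ b.support) :
    b.length (reflectionProd P l) ≤ l.length :=
  Nat.sInf_le ⟨l, hl, rfl, rfl⟩

variable {b} in
lemma IsFundamentalWeight.exists_natCast (h : b.IsFundamentalWeight ϖ) :
    ∀ j ∈ b.support, ∃ m : ℕ, P.coroot' j ϖ = m := by
  obtain ⟨i, -, hi, hne⟩ := h
  intro j hj
  rcases eq_or_ne j i with rfl | hji
  · exact ⟨1, by simpa using hi⟩
  · exact ⟨0, by simpa using hne j hj hji⟩

variable [Finite ι] [P.IsRootSystem]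

lemma ofIdx_weylInvolution (i : ι) :
    weylGroup.ofIdx P (b.weylInvolution i) =
      b.longestElement * weylGroup.ofIdx P i * b.longestElement⁻¹ := by
  rw [← weylGroup_ofIdx_smul_conj]
  change weylGroup.ofIdx P (P.reflectionPerm _ _) = _
  rw [weylGroup_ofIdx_reflectionPerm, weylGroup_ofIdx_mul_self, one_mul]

lemma reflectionProd_map_weylInvolution (l : List ι) :
    reflectionProd P (l.map b.weylInvolution) =
      b.longestElement * reflectionProd P l * b.longestElement⁻¹ := by
  induction l with
  | nil => simp [reflectionProd]
  | cons i l ih =>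
    rw [List.map_cons, reflectionProd_cons, reflectionProd_cons, ih, ofIdx_weylInvolution]
    group

/-- Exhibits each $\alpha_k$ as the image of an inversion under an element that does not depend on
$k$. -/
lemma reflectionProd_map_weylInvolution_smul (l m : List ι) (i : ι) :
    reflectionProd P (l.map b.weylInvolution) • b.weylInvolution i =
      (b.longestElement * reflectionProd P (l ++ i :: m)) • (reflectionProd P m)⁻¹ • i := by
  -- The minus sign in the involution is absorbed as $-\gamma = s_\gamma(\gamma)$, which supplies
  -- the letter `i` missing after `l`.
  have hinv : b.weylInvolution i = b.longestElement • weylGroup.ofIdx P i • i := by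
    apply P.root.injective
    rw [root_weylInvolution, root_weylGroup_smul, weylGroup_ofIdx_smul_eq, root_reflectionPerm,
      reflection_apply_self]
    exact (smul_neg b.longestElement (P.root i)).symm
  rw [reflectionProd_map_weylInvolution, hinv, reflectionProd_append, reflectionProd_cons]
  simp only [smul_smul]
  congr 1
  group

end

/-! ### Positive roots, inversions and minuscule weights -/

variable {ι k V V' : Type*} [Finite ι]
    [Field k] [LinearOrder k] [IsStrictOrderedRing k]
    [AddCommGroup V] [Module k V] [AddCommGroup V'] [Module k V']
    {P : RootPairing ι k V V'} [P.IsCrystallographic] [P.IsReduced]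
    {b : P.Base} {ϖ : V}

/-- Induction on positive roots: a positive root which is not simple is lowered to a positive root
by a suitable simple reflection. -/
lemma IsPos.induction_on_lower {i : ι} (h₀ : b.IsPos i) {p : ι → Prop}
    (h₁ : ∀ i ∈ b.support, p i)
    (h₂ : ∀ i j, b.IsPos (P.reflectionPerm j i) → j ∈ b.support → 0 < P.pairingIn ℤ j i →
      p (P.reflectionPerm j i) → p i) :
    p i := by
  generalize hN : (b.height i).toNat = N
  induction N using Nat.strongRecOn generalizing i with
  | ind n ih =>
    obtain ⟨j, hj, hj'⟩ := h₀.exists_mem_support_pos_pairingIn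
    rcases eq_or_ne i j with rfl | hij
    · exact h₁ i hj
    have hk := h₀.reflectionPerm hj hij
    refine h₂ i j hk hj hj' (ih _ ?_ hk rfl)
    have hr := P.reflection_apply_root' ℤ (i := j) (j := i)
    rw [← root_reflectionPerm, sub_eq_add_neg, ← neg_smul] at hr
    have hh := b.height_add_zsmul hr
    rw [height_one_of_mem_support hj] at hh
    rw [P.zero_lt_pairingIn_iff'] at hj'
    rw [isPos_iff] at h₀ hk
    simp only [smul_eq_mul, mul_one] at hh
    lia

lemma IsPos.coroot'_eq_natCast {i : ι} (hi : b.IsPos i)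
    (hϖ : ∀ j ∈ b.support, ∃ m : ℕ, P.coroot' j ϖ = m) : ∃ m : ℕ, P.coroot' i ϖ = m := by
  refine hi.induction_on_lower hϖ fun i j _ hj hji ⟨m, hm⟩ ↦ ?_
  obtain ⟨c, -, hc⟩ := pairing_eq_natCast_of_pos hji
  obtain ⟨a, ha⟩ := hϖ j hj
  rw [coroot'_reflectionPerm_apply, hc, ha] at hm
  exact ⟨m + c * a, by push_cast; linarith⟩

/-- Lowering writes the coroot of `i` as that of a lower positive root plus a positive multiple of a
simple coroot. Both terms are nonnegative on $\varpi$, so both vanish there, and $s_i$ is a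
conjugate $s_j s_{s_j(i)} s_j$ inside the subgroup. -/
lemma IsPos.ofIdx_mem_parabolicWeylSubgroup {i : ι} (hi : b.IsPos i)
    (hϖ : ∀ j ∈ b.support, ∃ m : ℕ, P.coroot' j ϖ = m) (h₀ : P.coroot' i ϖ = 0) :
    weylGroup.ofIdx P i ∈ b.parabolicWeylSubgroup ϖ := by
  revert h₀
  refine hi.induction_on_lower
    (p := fun i ↦ P.coroot' i ϖ = 0 → weylGroup.ofIdx P i ∈ b.parabolicWeylSubgroup ϖ)
    (fun i hi h₀ ↦ Subgroup.subset_closure ⟨i, ⟨hi, h₀⟩, rfl⟩)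
    fun i j hk hj hji ih h₀ ↦ ?_
  obtain ⟨c, hc₀, hc⟩ := pairing_eq_natCast_of_pos hji
  obtain ⟨a, ha⟩ := hϖ j hj
  obtain ⟨m, hm⟩ := hk.coroot'_eq_natCast hϖ
  have hm' := hm
  rw [coroot'_reflectionPerm_apply, hc, ha, h₀] at hm'
  have hsum : m + c * a = 0 := by
    have : ((m + c * a : ℕ) : k) = 0 := by push_cast; linarith
    exact_mod_cast this
  have ha₀ : a = 0 := by
    rcases Nat.mul_eq_zero.mp (Nat.add_eq_zero_iff.mp hsum).2 with h | h <;> lia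
  have hm₀ : m = 0 := (Nat.add_eq_zero_iff.mp hsum).1
  have hjP : weylGroup.ofIdx P j ∈ b.parabolicWeylSubgroup ϖ :=
    Subgroup.subset_closure ⟨j, ⟨hj, by rw [ha, ha₀, Nat.cast_zero]⟩, rfl⟩
  have hkP := ih (by rw [hm, hm₀, Nat.cast_zero])
  have := mul_mem (mul_mem hjP hkP) hjP
  rwa [← weylGroup_ofIdx_reflectionPerm, P.reflectionPerm_self] at this

/-- The exchange condition. -/
lemma exists_reflectionProd_eq_ofIdx_mul {i : ι} (hi : b.IsPos i) {l : List ι}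
    (hl : ∀ j ∈ l, j ∈ b.support) (h : ¬ b.IsPos ((reflectionProd P l)⁻¹ • i)) :
    ∃ m : List ι, (∀ j ∈ m, j ∈ b.support) ∧ m.length + 1 = l.length ∧
      reflectionProd P m = weylGroup.ofIdx P i * reflectionProd P l := by
  induction l generalizing i with
  | nil => exact absurd (by simpa [reflectionProd] using hi) h
  | cons j t ih =>
    have ht : ∀ x ∈ t, x ∈ b.support := fun x hx ↦ hl x (List.mem_cons_of_mem j hx)
    have hj : j ∈ b.support := hl j List.mem_cons_self
    rcases eq_or_ne i j with rfl | hij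
    · refine ⟨t, ht, rfl, ?_⟩
      rw [reflectionProd_cons, ← mul_assoc, weylGroup_ofIdx_mul_self, one_mul]
    -- A simple reflection $s_j$ keeps every positive root other than `j` positive, so the deletion
    -- takes place in the tail, applied to $s_j(i)$.
    · rw [reflectionProd_cons, mul_inv_rev,
        inv_eq_of_mul_eq_one_left (P.weylGroup_ofIdx_mul_self j), mul_smul,
        weylGroup_ofIdx_smul_eq] at h
      obtain ⟨m, hm, hmt, hmr⟩ := ih (hi.reflectionPerm hj hij) ht h
      refine ⟨j :: m, List.forall_mem_cons.mpr ⟨hj, hm⟩, by simpa using hmt, ?_⟩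
      rw [reflectionProd_cons, reflectionProd_cons, hmr, weylGroup_ofIdx_reflectionPerm]
      simp only [← mul_assoc]
      rw [weylGroup_ofIdx_mul_self, one_mul]

/-- The inversions of the element given by a reduced word are positive roots. -/
lemma isPos_of_length_eq {l m : List ι} {i : ι} (h : ∀ j ∈ l ++ i :: m, j ∈ b.support)
    (hlen : b.length (reflectionProd P (l ++ i :: m)) = (l ++ i :: m).length) :
    b.IsPos ((reflectionProd P m)⁻¹ • i) := by
  simp only [List.forall_mem_append, List.forall_mem_cons] at h
  obtain ⟨hl, hi, hm⟩ := h
  by_contra hneg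
  -- Otherwise exchange shortens `i :: m` by two letters, contradicting reducedness.
  obtain ⟨m', hm', hlen', hprod⟩ :=
    exists_reflectionProd_eq_ofIdx_mul (isPos_of_mem_support hi) hm hneg
  have hle := b.length_reflectionProd_le (l := l ++ m') (List.forall_mem_append.mpr ⟨hl, hm'⟩)
  rw [reflectionProd_append, hprod, ← reflectionProd_cons, ← reflectionProd_append, hlen] at hle
  simp only [List.length_append, List.length_cons] at hle
  lia

/-- The coroot of an inversion of a minimal coset representative has nonzero pairing with the
weight. -/
lemma coroot'_ne_zero_of_isMinimalRepresentative {l m : List ι} {i : ι}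
    (hϖ : ∀ j ∈ b.support, ∃ m : ℕ, P.coroot' j ϖ = m)
    (h : ∀ j ∈ l ++ i :: m, j ∈ b.support)
    (hlen : b.length (reflectionProd P (l ++ i :: m)) = (l ++ i :: m).length)
    (hmin : b.IsMinimalRepresentative ϖ (reflectionProd P (l ++ i :: m))) :
    P.coroot' ((reflectionProd P m)⁻¹ • i) ϖ ≠ 0 := by
  intro h₀
  have hle := hmin _ ((isPos_of_length_eq h hlen).ofIdx_mem_parabolicWeylSubgroup hϖ h₀)
  have hdel : reflectionProd P (l ++ i :: m) *
      weylGroup.ofIdx P ((reflectionProd P m)⁻¹ • i) = reflectionProd P (l ++ m) := by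
    rw [weylGroup_ofIdx_smul_conj, reflectionProd_append, reflectionProd_append,
      reflectionProd_cons]
    calc _ = reflectionProd P l * (weylGroup.ofIdx P i * weylGroup.ofIdx P i) *
          reflectionProd P m := by group
      _ = _ := by rw [weylGroup_ofIdx_mul_self, mul_one]
  simp only [List.forall_mem_append, List.forall_mem_cons] at h
  have hle' := b.length_reflectionProd_le (l := l ++ m) (List.forall_mem_append.mpr ⟨h.1, h.2.2⟩)
  rw [hdel, hlen] at hle
  simp only [List.length_append, List.length_cons] at hle hle'
  lia

lemma IsMinuscule.coroot'_le_one (h : b.IsMinuscule ϖ) (i : ι) : P.coroot' i ϖ ≤ 1 := by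
  let := P.indexNeg
  rcases IsPos.or_neg b i with hi | hi
  · exact h.2 i hi
  · obtain ⟨m, hm⟩ := hi.coroot'_eq_natCast h.1.exists_natCast
    have hneg : P.coroot' (-i) ϖ = -P.coroot' i ϖ := P.coroot'_reflectionPerm_self_apply i ϖ
    have : (0 : k) ≤ m := m.cast_nonneg
    linarith

/-- Two roots whose coroots pair to one with a minuscule weight do not form an obtuse angle. -/
lemma IsMinuscule.pairing_nonneg (h : b.IsMinuscule ϖ) {i j : ι} (hi : P.coroot' i ϖ = 1)
    (hj : P.coroot' j ϖ = 1) : 0 ≤ P.pairing i j := by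
  -- The reflected coroot takes the value `1 - P.pairing i j` on $\varpi$.
  have hle := h.coroot'_le_one (P.reflectionPerm i j)
  rw [coroot'_reflectionPerm_apply, hi, hj] at hle
  linarith

end Base

end RootPairing

end

theorem mainTheorem4 {ι k V V' : Type*} [Finite ι]
    [Field k] [LinearOrder k] [IsStrictOrderedRing k]
    [AddCommGroup V] [Module k V] [AddCommGroup V'] [Module k V']
    (P : RootPairing ι k V V') [P.IsRootSystem] [P.IsCrystallographic] [P.IsReduced]
    (b : P.Base) (ϖ : V) (hϖ : b.IsMinuscule ϖ)
    (n : ℕ) (γ : Fin n → ι) (hγ : ∀ i, γ i ∈ b.support)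
    (φ : P.weylGroup) (hφ : φ = RootPairing.reflectionProd P (List.ofFn γ))
    (hn : b.length φ = n) (hmin : b.IsMinimalRepresentative ϖ φ)
    (β : Fin n → ι) (hβ : ∀ i, β i = b.weylInvolution (γ i))
    (α : Fin n → ι) (hα : ∀ i, α i = RootPairing.associatedRoots P β i) :
    ∀ i j : Fin n, 0 ≤ P.coroot' (α i) (P.root (α j)) := by
  subst hφ
  have hβ' : List.ofFn β = (List.ofFn γ).map b.weylInvolution := by
    rw [List.map_ofFn]; exact congrArg List.ofFn (funext hβ)
  have key (i : Fin n) : ∃ e : ι, P.coroot' e ϖ = 1 ∧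
      α i = (b.longestElement * RootPairing.reflectionProd P (List.ofFn γ)) • e := by
    have hsplit : List.ofFn γ =
        (List.ofFn γ).take i ++ γ i :: (List.ofFn γ).drop (i + 1) := by
      conv_lhs => rw [← List.take_append_drop i (List.ofFn γ)]
      rw [List.drop_eq_getElem_cons (by simp)]
      simp
    have hmem : ∀ j ∈ List.ofFn γ, j ∈ b.support := by
      intro j hj
      obtain ⟨x, rfl⟩ := (List.mem_ofFn' γ j).mp hj
      exact hγ x
    have hlen : b.length (RootPairing.reflectionProd P (List.ofFn γ)) = (List.ofFn γ).length := by
      simpa using hn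
    refine ⟨(RootPairing.reflectionProd P ((List.ofFn γ).drop (i + 1)))⁻¹ • γ i, ?_, ?_⟩
    · rw [hsplit] at hmem hlen hmin
      have hpos := RootPairing.Base.isPos_of_length_eq hmem hlen
      have hne := RootPairing.Base.coroot'_ne_zero_of_isMinimalRepresentative
        hϖ.1.exists_natCast hmem hlen hmin
      have hle := hϖ.2 _ hpos
      obtain ⟨m, hm⟩ := hpos.coroot'_eq_natCast hϖ.1.exists_natCast
      rw [hm] at hne hle ⊢
      have h₁ : m ≠ 0 := by exact_mod_cast hne
      have h₂ : m ≤ 1 := by exact_mod_cast hle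
      have h₃ : m = 1 := by lia
      exact_mod_cast h₃
    · rw [hα, RootPairing.associatedRoots, hβ', ← List.map_take, hβ,
        b.reflectionProd_map_weylInvolution_smul _ ((List.ofFn γ).drop (i + 1)), ← hsplit]
  intro i j
  obtain ⟨e, he, hei⟩ := key i
  obtain ⟨f, hf, hfj⟩ := key j
  rw [hei, hfj, P.root_coroot'_eq_pairing, P.pairing_weylGroup_smul]
  exact hϖ.pairing_nonneg hf he
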